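/- Let $\phi:\mathbb T\to\mathbb T$, $\mathbb T=\mathbb R/\mathbb Z$, be an irrational rotation, $\phi(x)=x+\alpha$ with $\alpha\in\mathbb R\setminus\mathbb Q$. There is a continuous function $F:\mathbb T\to\mathbb R$ such that 1. for every $\beta\in\mathbb R$ there is an $e^{\beta F}$-conformal measure; 2. for every $\beta\ge 0$ there is exactly one ergodic $e^{\beta F}$-conformal measure of type $II_1$; 3. for every $\beta<0$ every ergodic $e^{\beta F}$-conformal measure is of type $II_\infty$ or of type $III$. Here the following definitions are used. An *$e^{\beta F}$-conformal measure* is a Borel probability measure $m$ on $\mathbb T$ with $m(\phi(B))=\int_B e^{\beta F}\,\mathrm dm$ for all Borel sets $B$; it is *ergodic* if $m(B)\in\{0,1\}$ for every Borel set $B$ with $\phi^{-1}(B)=B$. Put $S_k=\sum_{j=0}^{k-1}F\circ\phi^j$ for $k\ge 0$ and $S_{k}=-\sum_{j=1}^{|k|}F\circ\phi^{-j}$ for $k<0$, and for fixed $\beta$ let - $M_{I}$ be the set of points $x$ with $\sum_{n\in\mathbb Z}e^{\beta S_n(x)}<\infty$, together with all $x$ that are $\phi$-periodic, of minimal period $p\ge1$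 say, with $S_p(x)=0$ (there are no periodic points for an irrational rotation); - $M_{II_1}=\{x:\ \liminf_{n}\frac1n\sum_{j=1}^n e^{\beta S_j(x)}>0\}\setminus M_I$, the lower limit being taken in $[0,\infty]$; - $M_{III}$ be a $\phi$-invariant Borel set such that there is a Borel function $u:\mathbb T\setminus M_{III}\to\mathbb R$ with $\beta F=u\circ\phi-u$ on $\mathbb T\setminus M_{III}$, while $m(A)=0$ for every $\phi$-invariant Borel set $A\subseteq M_{III}$ on which there is a Borel function $u:A\to\mathbb R$ with $\beta F=u\circ\phi-u$ (such a set exists for every $e^{\beta F}$-conformal measure $m$ and is unique up to $m$-null sets); - $M_{II_\infty}=\mathbb T\setminus(M_I\cup M_{II_1}\cup M_{III})$. For $t\in\{II_1,II_\infty,III\}$, the measure $m$ is *of type $t$* if $m(M_t)=1$. -/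

import Mathlib

open MeasureTheory Filter Set

namespace CrossedFlow

noncomputable section

variable {X : Type*} [TopologicalSpace X]

/-- The two-sided Birkhoff sums of a potential `F` along a homeomorphism `φ`:
`S_k(F) = ∑_{j=0}^{k-1} F ∘ φ^j` for `k ≥ 0` and `S_k(F) = -∑_{j=1}^{|k|} F ∘ φ^{-j}` for `k < 0`
(the integer `Int.negSucc n` is `-(n+1)`). -/
def orbitSum (φ : X ≃ₜ X) (F : X → ℝ) : ℤ → X → ℝ
  | Int.ofNat n, x => ∑ j ∈ Finset.range n, F (φ^[j] x)
  | Int.negSucc n, x => -∑ j ∈ Finset.Icc 1 (n + 1), F (φ.symm^[j] x)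

/-- The set `M_{I_p}` (used for `p ≥ 1`): points of minimal period `p` over whose orbit `F` sums
to zero. -/
def typeIpSet (φ : X ≃ₜ X) (F : X → ℝ) (p : ℕ) : Set X :=
  {x | φ^[p] x = x ∧ (∀ j, 1 ≤ j → j < p → φ^[j] x ≠ x) ∧ orbitSum φ F p x = 0}

/-- The set `M_{I_∞}`: points with `∑_{n ∈ ℤ} e^{β S_n(F)(x)} < ∞`. -/
def typeIInftySet (φ : X ≃ₜ X) (F : X → ℝ) (β : ℝ) : Set X :=
  {x | Summable fun n : ℤ => Real.exp (β * orbitSum φ F n x)}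

/-- The set `M_I = M_{I_∞} ∪ ⋃_{p ≥ 1} M_{I_p}`. -/
def typeISet (φ : X ≃ₜ X) (F : X → ℝ) (β : ℝ) : Set X :=
  typeIInftySet φ F β ∪ ⋃ p : ℕ, ⋃ _ : 1 ≤ p, typeIpSet φ F p

/-- The set `M_{II_1}`: points outside `M_I` with
`liminf_n (1/n) ∑_{j=1}^n e^{β S_j(F)(x)} > 0`. The lower limit is taken in `[0, ∞]`,
since the averages may be unbounded. -/
def typeIIOneSet (φ : X ≃ₜ X) (F : X → ℝ) (β : ℝ) : Set X :=
  {x | 0 < liminf (fun n : ℕ => ENNReal.ofReal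
      ((1 / (n : ℝ)) * ∑ j ∈ Finset.Icc 1 n, Real.exp (β * orbitSum φ F (j : ℤ) x))) atTop}
    \ typeISet φ F β

variable [MeasurableSpace X]

/-- An `e^{βF}`-conformal measure for `φ`: a Borel probability measure `m` with
`m(φ(B)) = ∫_B e^{βF} dm` for all Borel sets `B`. -/
structure IsConformal (φ : X ≃ₜ X) (F : X → ℝ) (β : ℝ) (m : Measure X) : Prop where
  isProbabilityMeasure : IsProbabilityMeasure m
  measure_image : ∀ B : Set X, MeasurableSet B →
    m (φ '' B) = ∫⁻ x in B, ENNReal.ofReal (Real.exp (β * F x)) ∂m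

/-- `IsTypeIIIPart φ F β m S` says that `S` is a possible choice of the set `M_{III}` of `m`:
an invariant Borel set such that the equation `βF = u ∘ φ - u` has a Borel solution on the
complement of `S`, and has none on an invariant Borel subset of `S` of positive measure.
For conformal `m` such a set exists and is unique up to an `m`-null set.
(Borel functions on a Borel subset are written as restrictions of Borel functions on `X`.) -/
structure IsTypeIIIPart (φ : X ≃ₜ X) (F : X → ℝ) (β : ℝ) (m : Measure X) (S : Set X) : Prop where
  measurableSet : MeasurableSet S
  invariant : φ ⁻¹' S = S
  exists_solution : ∃ u : X → ℝ, Measurable u ∧ ∀ x ∈ Sᶜ, β * F x = u (φ x) - u x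
  no_solution : ∀ A : Set X, A ⊆ S → MeasurableSet A → φ ⁻¹' A = A →
    ∀ u : X → ℝ, Measurable u → (∀ x ∈ A, β * F x = u (φ x) - u x) → m A = 0

/-- `m` is of type `II_1`: `m(M_{II_1}) = 1`. -/
def IsTypeIIOne (φ : X ≃ₜ X) (F : X → ℝ) (β : ℝ) (m : Measure X) : Prop :=
  m (typeIIOneSet φ F β) = 1

/-- `m` is of type `II_∞`: `m(M_{II_∞}) = 1`, where
`M_{II_∞} = X \ (M_I ∪ M_{II_1} ∪ M_{III})`. -/
def IsTypeIIInfty (φ : X ≃ₜ X) (F : X → ℝ) (β : ℝ) (m : Measure X) : Prop :=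
  ∃ S : Set X, IsTypeIIIPart φ F β m S ∧
    m (typeISet φ F β ∪ typeIIOneSet φ F β ∪ S)ᶜ = 1

/-- `m` is of type `III`: `m(M_{III}) = 1`. -/
def IsTypeIII (φ : X ≃ₜ X) (F : X → ℝ) (β : ℝ) (m : Measure X) : Prop :=
  ∃ S : Set X, IsTypeIIIPart φ F β m S ∧ m S = 1

end

end CrossedFlow

open scoped Topology

namespace CrossedFlow

/-! The potential is a uniformly convergent series of coboundaries, F = Σ (v_k - v_k ∘ φ), with
continuous spikes v_k ≥ 0 of height 4^k living on sets of measure at most 2·2⁻ᵏ. By Borel–Cantelli w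
= Σ v_k is finite a.e., so F = w - w ∘ φ a.e., and e^{-βw}, once normalised, is a conformal density
whenever it is integrable. It is bounded by 1 for β ≥ 0 but has infinite integral for β < 0.

Let h be the lower limit of the averages of e^{βS_j}. Since (h ∘ φ) e^{βF} = h, the measure h·m is
invariant for every conformal m. It is finite by Fatou, hence a multiple of Lebesgue measure by
unique ergodicity. If m has type II₁, then h > 0 a.e. and m = c h⁻¹·vol
(`IsConformal.exists_eq_smul_withDensity`), which gives uniqueness. For β < 0 the same formula makes
h⁻¹ a multiple of the non-integrable e^{-βw} (`not_ae_lowerExpAverage_pos`). For β ≥ 0 a maximal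
inequality gives h > 0 a.e. (`ae_lowerExpAverage_pos`), so the measure with density e^{-βw} has type
II₁.

Return times with bounded orbit sums exclude type I. Weak limits give a conformal measure for each
β, and ergodicity leaves only II_∞ or III when β < 0. -/

/-! ### Return times of the rotation -/

/-- Every rotation of the circle returns arbitrarily close to the identity at arbitrarily late
times. -/
lemma exists_lt_norm_nsmul_le (a : UnitAddCircle) {ε : ℝ} (hε : 0 < ε) (N : ℕ) :
    ∃ y : ℕ, N < y ∧ ‖y • a‖ ≤ ε := by
  obtain ⟨M, hM⟩ := exists_nat_gt ((N + 1) / ε)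
  have hM0 : 0 < M := by
    have : (0 : ℝ) < M := lt_trans (by positivity) hM
    exact_mod_cast this
  obtain ⟨j, hj, hja⟩ := AddCircle.exists_norm_nsmul_le a hM0
  -- Dirichlet's `j` may be small; the factor `N + 1` pushes it past `N`, and `M` was chosen to
  -- absorb that factor.
  refine ⟨(N + 1) * j, ?_, ?_⟩
  · have := hj.1
    nlinarith
  · rw [mul_nsmul']
    have h1 : ‖(N + 1) • (j • a)‖ ≤ (N + 1 : ℕ) * ‖j • a‖ := norm_nsmul_le
    refine h1.trans ?_
    rw [div_lt_iff₀ hε] at hM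
    have h2 : ((N + 1 : ℕ) : ℝ) * ‖j • a‖ ≤ (N + 1 : ℕ) * (1 / (M + 1)) := by
      push_cast at hja ⊢
      gcongr
    refine h2.trans ?_
    push_cast
    rw [mul_one_div, div_le_iff₀ (by positivity)]
    nlinarith

/-- Two interlaced sequences of return times of a rotation, each time being almost negligible for
all the other ones. -/
lemma exists_interlaced_return_times (a : UnitAddCircle) :
    ∃ q n : ℕ → ℕ, (∀ k, q k ≠ 0) ∧ StrictMono n ∧ (∀ k, (16 : ℝ) ^ k * ‖q k • a‖ ≤ 1) ∧
      ∀ i k, (16 : ℝ) ^ k * ‖(q k * n i) • a‖ ≤ 1 := by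
  obtain ⟨f, hf1, hf⟩ := exists_seq_of_forall_finset_exists (fun y : ℕ => 0 < y)
    (fun x y => x < y ∧ (16 : ℝ) ^ x * x * ‖y • a‖ ≤ 1) (by
      intro s _
      obtain ⟨y, hy, hya⟩ := exists_lt_norm_nsmul_le a
        (ε := ((16 : ℝ) ^ (s.sup id) * (s.sup id + 1))⁻¹) (by positivity) (s.sup id)
      refine ⟨y, by omega, fun x hx => ?_⟩
      have hxs : x ≤ s.sup id := Finset.le_sup (f := id) hx
      refine ⟨by omega, ?_⟩
      calc (16 : ℝ) ^ x * x * ‖y • a‖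
          ≤ (16 : ℝ) ^ (s.sup id) * (s.sup id + 1) *
            ((16 : ℝ) ^ (s.sup id) * (s.sup id + 1))⁻¹ := by
            have : (x : ℝ) ≤ (s.sup id : ℕ) := by exact_mod_cast hxs
            gcongr
            · norm_num
            · linarith
        _ = 1 := mul_inv_cancel₀ (by positivity))
  have hmono : StrictMono f := fun i j hij => (hf i j hij).1
  have key : ∀ x y k : ℕ, 1 ≤ x → k ≤ x → (16 : ℝ) ^ x * x * ‖y • a‖ ≤ 1 →
      ∀ z : ℕ, z ≤ x → (16 : ℝ) ^ k * ‖(z * y) • a‖ ≤ 1 := by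
    intro x y k hx hk h z hz
    refine le_trans ?_ h
    rw [mul_nsmul']
    have h1 : ‖z • (y • a)‖ ≤ z * ‖y • a‖ := norm_nsmul_le
    have hz' : (z : ℝ) ≤ x := by exact_mod_cast hz
    calc (16 : ℝ) ^ k * ‖z • (y • a)‖ ≤ (16 : ℝ) ^ x * (x * ‖y • a‖) := by
          gcongr
          · norm_num
          · exact h1.trans (by gcongr)
      _ = _ := by ring
  -- Odd terms of one sequence serve as `q`, even terms as `n`. In a product `q k * n i` the later
  -- term makes the multiple of `a` tiny, and the earlier one is a harmless factor.
  refine ⟨fun k => f (2 * k + 1), fun i => f (2 * i), fun k => (hf1 (2 * k + 1)).ne',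
    fun i j hij => hmono (by omega), fun k => ?_, fun i k => ?_⟩
  · have := key (f (2 * k)) (f (2 * k + 1)) k (hf1 _) (by have := hmono.id_le (2 * k); simp at this; omega)
      (hf _ _ (by omega)).2 1 (hf1 _)
    simpa using this
  · rcases Nat.lt_or_ge k i with h | h
    · exact key (f (2 * k + 1)) (f (2 * i)) k (hf1 _)
        (by have := hmono.id_le (2 * k + 1); simp at this; omega) (hf _ _ (by omega)).2 _ le_rfl
    · have := key (f (2 * k)) (f (2 * k + 1)) k (hf1 _)
        (by have := hmono.id_le (2 * k); simp at this; omega) (hf _ _ (by omega)).2 (f (2 * i))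
        (hmono.monotone (by omega))
      rwa [mul_comm (f _)] at this

/-! ### Spikes -/

/-- A continuous function on the circle of height `4 ^ k` and support of measure at most
`2 * 2⁻ᵏ`, almost invariant under translations by `b` when `q • b` is small. -/
noncomputable def spike (q k : ℕ) : C(UnitAddCircle, ℝ) where
  toFun x := max 0 (4 ^ k - 8 ^ k * ‖q • x‖)
  continuous_toFun := by fun_prop

lemma spike_apply (q k : ℕ) (x : UnitAddCircle) :
    spike q k x = max 0 (4 ^ k - 8 ^ k * ‖q • x‖) := rfl

lemma abs_spike_sub_le (q k : ℕ) (x b : UnitAddCircle) :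
    |spike q k x - spike q k (x + b)| ≤ 8 ^ k * ‖q • b‖ := by
  rw [spike_apply, spike_apply, max_comm 0, max_comm 0]
  refine (abs_max_sub_max_le_abs _ _ _).trans ?_
  have h : |‖q • (x + b)‖ - ‖q • x‖| ≤ ‖q • b‖ := by
    refine (abs_norm_sub_norm_le _ _).trans_eq ?_
    rw [smul_add, add_sub_cancel_left]
  calc |(4 : ℝ) ^ k - 8 ^ k * ‖q • x‖ - (4 ^ k - 8 ^ k * ‖q • (x + b)‖)|
      = 8 ^ k * |‖q • (x + b)‖ - ‖q • x‖| := by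
        rw [← abs_of_pos (show (0 : ℝ) < 8 ^ k by positivity), ← abs_mul]
        rw [abs_of_pos (show (0 : ℝ) < 8 ^ k by positivity)]
        ring_nf
    _ ≤ _ := by gcongr

/-- Multiplication by `q` preserves Haar measure, so the size of a spike does not depend on the
return time it is built from. -/
lemma volume_nsmul_preimage_closedBall {q : ℕ} (hq : q ≠ 0) (r : ℝ) :
    volume ((fun x : UnitAddCircle => q • x) ⁻¹' Metric.closedBall 0 r)
      = ENNReal.ofReal (min 1 (2 * r)) := by
  have h := MeasureTheory.Measure.measurePreserving_zsmul (volume : Measure UnitAddCircle)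
    (n := (q : ℤ)) (by exact_mod_cast hq)
  simp only [natCast_zsmul] at h
  rw [h.measure_preimage Metric.isClosed_closedBall.measurableSet.nullMeasurableSet,
    AddCircle.volume_closedBall]

lemma volume_spike_ne_zero_le {q : ℕ} (hq : q ≠ 0) (k : ℕ) :
    volume {x | spike q k x ≠ 0} ≤ ENNReal.ofReal (2 * (1 / 2) ^ k) := by
  calc volume {x | spike q k x ≠ 0}
      ≤ volume ((fun x : UnitAddCircle => q • x) ⁻¹' Metric.closedBall 0 ((1 / 2) ^ k)) := by
        refine measure_mono fun x hx => ?_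
        rw [mem_preimage, mem_closedBall_zero_iff]
        by_contra! h
        refine hx ?_
        rw [spike_apply, max_eq_left]
        have : (8 : ℝ) ^ k * (1 / 2) ^ k = 4 ^ k := by rw [← mul_pow]; norm_num
        have : (8 : ℝ) ^ k * (1 / 2) ^ k ≤ 8 ^ k * ‖q • x‖ := by gcongr
        linarith
    _ ≤ _ := by
        rw [volume_nsmul_preimage_closedBall hq]
        exact ENNReal.ofReal_le_ofReal (min_le_right _ _)

/-- On a set of measure 2⁻ᵏ the spike is at least half its height; with e^t ≥ t, the height 4^k
outweighs the small support. -/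
lemma le_lintegral_exp_spike {q : ℕ} (hq : q ≠ 0) (k : ℕ) {ε : ℝ} (hε : 0 < ε) :
    ENNReal.ofReal (ε * 2 ^ k / 2) ≤ ∫⁻ x, ENNReal.ofReal (Real.exp (ε * spike q k x)) := by
  set B := (fun x : UnitAddCircle => q • x) ⁻¹' Metric.closedBall 0 ((1 / 2) ^ k / 2) with hB
  have hBm : MeasurableSet B :=
    (Metric.isClosed_closedBall.preimage (by fun_prop)).measurableSet
  have hle : (1 / 2 : ℝ) ^ k ≤ 1 := pow_le_one₀ (by norm_num) (by norm_num)
  calc ENNReal.ofReal (ε * 2 ^ k / 2)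
      = ENNReal.ofReal (ε * (4 ^ k / 2)) * volume B := by
        rw [volume_nsmul_preimage_closedBall hq, ← ENNReal.ofReal_mul (by positivity)]
        congr 1
        rw [mul_div_cancel₀ _ two_ne_zero, min_eq_right hle]
        have : (4 : ℝ) ^ k * (1 / 2) ^ k = 2 ^ k := by rw [← mul_pow]; norm_num
        rw [← this]; ring
    _ = ∫⁻ _ in B, ENNReal.ofReal (ε * (4 ^ k / 2)) := by simp
    _ ≤ ∫⁻ x in B, ENNReal.ofReal (Real.exp (ε * spike q k x)) := by
        refine setLIntegral_mono' hBm fun x hx => ENNReal.ofReal_le_ofReal ?_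
        rw [hB, mem_preimage, mem_closedBall_zero_iff] at hx
        have h1 : (4 : ℝ) ^ k / 2 ≤ spike q k x := by
          rw [spike_apply]
          refine le_trans ?_ (le_max_right _ _)
          have : (8 : ℝ) ^ k * ((1 / 2) ^ k / 2) = 4 ^ k / 2 := by
            rw [← mul_div_assoc, ← mul_pow]; norm_num
          have : (8 : ℝ) ^ k * ‖q • x‖ ≤ 8 ^ k * ((1 / 2) ^ k / 2) := by gcongr
          linarith
        have h2 : ε * (4 ^ k / 2) ≤ ε * spike q k x := by gcongr
        have := Real.add_one_le_exp (ε * spike q k x)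
        linarith
    _ ≤ _ := setLIntegral_le_lintegral _ _

/-- A sequence of nonnegative functions on the circle whose coboundaries along the rotation by `a`
are summable, also along infinitely many iterates of the rotation, and whose sum is almost
everywhere finite without having any integrable exponential. -/
structure IsSpikeSequence (a : UnitAddCircle) (v : ℕ → C(UnitAddCircle, ℝ)) : Prop where
  nonneg : ∀ k x, 0 ≤ v k x
  abs_sub_le : ∀ k x, |v k x - v k (x + a)| ≤ (1 / 2) ^ k
  exists_return : ∃ n : ℕ → ℕ, StrictMono n ∧
    ∀ i k x, |v k x - v k (x + n i • a)| ≤ (1 / 2) ^ k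
  volume_ne_zero_le : ∀ k, volume {x | v k x ≠ 0} ≤ ENNReal.ofReal (2 * (1 / 2) ^ k)
  le_lintegral_exp : ∀ k, ∀ ε : ℝ, 0 < ε →
    ENNReal.ofReal (ε * 2 ^ k / 2) ≤ ∫⁻ x, ENNReal.ofReal (Real.exp (ε * v k x))

lemma exists_isSpikeSequence (a : UnitAddCircle) :
    ∃ v : ℕ → C(UnitAddCircle, ℝ), IsSpikeSequence a v := by
  obtain ⟨q, n, hq, hn, h1, h2⟩ := exists_interlaced_return_times a
  have key : ∀ (k : ℕ) (t : ℝ), 16 ^ k * t ≤ 1 → 8 ^ k * t ≤ (1 / 2) ^ k := by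
    intro k t ht
    have h : (16 : ℝ) ^ k * (1 / 2) ^ k = 8 ^ k := by rw [← mul_pow]; norm_num
    calc (8 : ℝ) ^ k * t = (1 / 2) ^ k * (16 ^ k * t) := by rw [← h]; ring
      _ ≤ (1 / 2) ^ k * 1 := by gcongr
      _ = _ := mul_one _
  refine ⟨fun k => spike (q k) k, fun k x => le_max_left _ _, fun k x => ?_,
    ⟨n, hn, fun i k x => ?_⟩, fun k => volume_spike_ne_zero_le (hq k) k,
    fun k ε hε => le_lintegral_exp_spike (hq k) k hε⟩
  · exact (abs_spike_sub_le _ _ _ _).trans (key _ _ (h1 k))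
  · refine (abs_spike_sub_le _ _ _ _).trans (key _ _ ?_)
    rw [← mul_nsmul']
    exact h2 i k

/-! ### The potential -/

/-- The sum of the coboundaries `v k - v k ∘ φ` along the rotation `φ` by `a`. -/
noncomputable def coboundarySum (a : UnitAddCircle) (v : ℕ → C(UnitAddCircle, ℝ))
    (x : UnitAddCircle) : ℝ :=
  ∑' k, (v k x - v k (x + a))

lemma summable_half_pow : Summable fun k : ℕ => (1 / 2 : ℝ) ^ k :=
  summable_geometric_of_lt_one (by norm_num) (by norm_num)

namespace IsSpikeSequence

variable {a : UnitAddCircle} {v : ℕ → C(UnitAddCircle, ℝ)}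

lemma summable (hv : IsSpikeSequence a v) (x : UnitAddCircle) :
    Summable fun k => v k x - v k (x + a) :=
  Summable.of_norm_bounded summable_half_pow fun k => hv.abs_sub_le k x

lemma continuous_coboundarySum (hv : IsSpikeSequence a v) : Continuous (coboundarySum a v) :=
  continuous_tsum (fun k => by fun_prop) summable_half_pow fun k x => hv.abs_sub_le k x

/-- Each coboundary telescopes along the orbit. The identity holds at every point, even where Σ v_k
diverges. -/
lemma hasSum_birkhoffSum (hv : IsSpikeSequence a v) (n : ℕ) (x : UnitAddCircle) :
    HasSum (fun k => v k x - v k (x + n • a))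
      (∑ j ∈ Finset.range n, coboundarySum a v (x + j • a)) := by
  induction n with
  | zero => simp [hasSum_zero]
  | succ n ih =>
    rw [Finset.sum_range_succ]
    have h : HasSum (fun k => v k (x + n • a) - v k (x + n • a + a))
      (coboundarySum a v (x + n • a)) := (hv.summable (x + n • a)).hasSum
    refine (ih.add h).congr_fun fun k => ?_
    rw [succ_nsmul, add_assoc]
    ring

lemma summable_add_iff (hv : IsSpikeSequence a v) (x : UnitAddCircle) :
    Summable (fun k => v k (x + a)) ↔ Summable (fun k => v k x) := by
  refine ⟨fun h => ((hv.summable x).add h).congr fun k => by ring,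
    fun h => (h.sub (hv.summable x)).congr fun k => by ring⟩

lemma ae_finite (hv : IsSpikeSequence a v) : ∀ᵐ x, ∀ᶠ k in atTop, v k x = 0 := by
  have h : ∑' k, volume {x | v k x ≠ 0} ≠ ⊤ := by
    refine ne_top_of_le_ne_top ?_ (ENNReal.tsum_le_tsum hv.volume_ne_zero_le)
    rw [← ENNReal.ofReal_tsum_of_nonneg (fun k => by positivity) (summable_half_pow.mul_left 2)]
    exact ENNReal.ofReal_ne_top
  filter_upwards [ae_eventually_notMem h] with x hx
  filter_upwards [hx] with k hk
  simpa using hk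

lemma ae_summable (hv : IsSpikeSequence a v) : ∀ᵐ x, Summable fun k => v k x := by
  filter_upwards [hv.ae_finite] with x hx
  obtain ⟨N, hN⟩ := eventually_atTop.1 hx
  refine summable_of_ne_finset_zero (s := Finset.range N) fun k hk => hN k ?_
  simpa using hk

end IsSpikeSequence

/-! ### Orbit sums and absence of type I -/

section rotation

variable {a : UnitAddCircle} {v : ℕ → C(UnitAddCircle, ℝ)} {φ : UnitAddCircle ≃ₜ UnitAddCircle}

lemma iterate_rotation (hφ : ∀ x, φ x = x + a) (n : ℕ) (x : UnitAddCircle) :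
    φ^[n] x = x + n • a := by
  induction n with
  | zero => simp
  | succ n ih => rw [Function.iterate_succ_apply', ih, hφ, succ_nsmul, add_assoc]

lemma orbitSum_natCast {X : Type*} [TopologicalSpace X] (φ : X ≃ₜ X) (F : X → ℝ) (n : ℕ) (x : X) :
    orbitSum φ F (n : ℤ) x = ∑ j ∈ Finset.range n, F (φ^[j] x) := rfl

lemma orbitSum_succ_left {X : Type*} [TopologicalSpace X] (φ : X ≃ₜ X) (F : X → ℝ) (n : ℕ) (x : X) :
    orbitSum φ F ((n + 1 : ℕ) : ℤ) x = F x + orbitSum φ F (n : ℤ) (φ x) := by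
  rw [orbitSum_natCast, orbitSum_natCast, Finset.sum_range_succ', add_comm]
  rfl

lemma IsSpikeSequence.hasSum_orbitSum (hv : IsSpikeSequence a v) (hφ : ∀ x, φ x = x + a)
    (n : ℕ) (x : UnitAddCircle) :
    HasSum (fun k => v k x - v k (x + n • a)) (orbitSum φ (coboundarySum a v) n x) := by
  simp only [orbitSum_natCast, iterate_rotation hφ]
  exact hv.hasSum_birkhoffSum n x

/-- No orbit carries an atomic conformal measure, because the rotation returns along times at which
the orbit sums are bounded. -/
lemma IsSpikeSequence.typeISet_eq_empty (hv : IsSpikeSequence a v) (hφ : ∀ x, φ x = x + a)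
    (ha : addOrderOf a = 0) (β : ℝ) : typeISet φ (coboundarySum a v) β = ∅ := by
  refine eq_empty_of_forall_notMem fun x hx => ?_
  rcases hx with hx | hx
  · obtain ⟨n, hn, hnv⟩ := hv.exists_return
    have hx' : Summable fun i : ℕ =>
        Real.exp (β * orbitSum φ (coboundarySum a v) (n i : ℤ) x) :=
      Summable.comp_injective hx (i := fun i : ℕ => (n i : ℤ))
        (Nat.cast_injective.comp hn.injective)
    -- At the return times the orbit sum is at most Σ 2⁻ᵏ = 2 in absolute value, so these terms
    -- cannot tend to zero.
    have hlow : ∀ i, Real.exp (-(|β| * 2)) ≤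
        Real.exp (β * orbitSum φ (coboundarySum a v) (n i : ℤ) x) := by
      intro i
      rw [Real.exp_le_exp]
      have h := hv.hasSum_orbitSum hφ (n i) x
      have h2 : |orbitSum φ (coboundarySum a v) (n i : ℤ) x| ≤ 2 := by
        rw [← tsum_geometric_two, ← h.tsum_eq]
        exact tsum_of_norm_bounded (f := fun k => v k x - v k (x + n i • a))
          summable_half_pow.hasSum fun k => hnv i k x
      have h3 := neg_abs_le (β * orbitSum φ (coboundarySum a v) (n i : ℤ) x)
      rw [abs_mul] at h3
      have := mul_le_mul_of_nonneg_left h2 (abs_nonneg β)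
      linarith
    have := ge_of_tendsto' hx'.tendsto_atTop_zero hlow
    exact absurd (Real.exp_pos (-(|β| * 2))) (by linarith)
  · simp only [mem_iUnion] at hx
    obtain ⟨p, hp, hx, -⟩ := hx
    rw [iterate_rotation hφ, add_eq_left] at hx
    exact addOrderOf_eq_zero_iff'.1 ha p hp hx

end rotation

/-! ### Lower averages and conformal measures -/

section general

variable {X : Type*} [TopologicalSpace X]

/-- The averages whose lower limit defines the type `II₁` part. -/
noncomputable def expAverage (φ : X ≃ₜ X) (F : X → ℝ) (β : ℝ) (n : ℕ) (x : X) : ENNReal :=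
  ENNReal.ofReal ((1 / (n : ℝ)) * ∑ j ∈ Finset.Icc 1 n, Real.exp (β * orbitSum φ F (j : ℤ) x))

/-- The lower limit of the averages of `e ^ (β S_j)`. -/
noncomputable def lowerExpAverage (φ : X ≃ₜ X) (F : X → ℝ) (β : ℝ) (x : X) : ENNReal :=
  liminf (fun n => expAverage φ F β n x) atTop

lemma typeIIOneSet_eq (φ : X ≃ₜ X) (F : X → ℝ) (β : ℝ) :
    typeIIOneSet φ F β = {x | 0 < lowerExpAverage φ F β x} \ typeISet φ F β := rfl

/-- Comes from S_{j+1}(x) = F(x) + S_j(φ x): the shift leaves the boundary term j = 1, and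
renormalising from n to n + 1 costs the factor 1 + 1/n. Both corrections disappear in the limit. -/
lemma expAverage_comp (φ : X ≃ₜ X) (F : X → ℝ) (β : ℝ) {n : ℕ} (hn : n ≠ 0) (x : X) :
    expAverage φ F β n (φ x) * ENNReal.ofReal (Real.exp (β * F x)) +
        ENNReal.ofReal (1 / (n : ℝ) * Real.exp (β * F x)) =
      ENNReal.ofReal (1 + 1 / (n : ℝ)) * expAverage φ F β (n + 1) x := by
  have hn' : (0 : ℝ) < n := by positivity
  have hsum : ∑ j ∈ Finset.Icc 1 (n + 1), Real.exp (β * orbitSum φ F (j : ℤ) x) =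
      Real.exp (β * F x) + (∑ j ∈ Finset.Icc 1 n, Real.exp (β * orbitSum φ F (j : ℤ) (φ x))) *
        Real.exp (β * F x) := by
    rw [← Finset.add_sum_Ioc_eq_sum_Icc (by omega), ← Finset.Icc_add_one_left_eq_Ioc,
      Finset.sum_mul]
    congr 1
    · rw [orbitSum_natCast]
      simp
    · rw [← Finset.map_add_right_Icc 1 n 1, Finset.sum_map]
      refine Finset.sum_congr rfl fun j _ => ?_
      rw [addRightEmbedding_apply, orbitSum_succ_left, ← Real.exp_add]
      ring_nf
  rw [expAverage, expAverage, ← ENNReal.ofReal_mul (by positivity),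
    ← ENNReal.ofReal_add (by positivity) (by positivity), ← ENNReal.ofReal_mul (by positivity),
    hsum]
  congr 1
  push_cast
  field_simp
  ring

lemma lowerExpAverage_comp (φ : X ≃ₜ X) (F : X → ℝ) (β : ℝ) (x : X) :
    lowerExpAverage φ F β (φ x) * ENNReal.ofReal (Real.exp (β * F x)) =
      lowerExpAverage φ F β x := by
  have h1 : Tendsto (fun n : ℕ => ENNReal.ofReal (1 / (n : ℝ) * Real.exp (β * F x))) atTop
      (nhds 0) := by
    rw [← ENNReal.ofReal_zero]
    refine ENNReal.tendsto_ofReal ?_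
    simpa using (tendsto_one_div_atTop_nhds_zero_nat (𝕜 := ℝ)).mul_const (Real.exp (β * F x))
  have h2 : Tendsto (fun n : ℕ => ENNReal.ofReal (1 + 1 / (n : ℝ))) atTop (nhds 1) := by
    rw [← ENNReal.ofReal_one]
    refine ENNReal.tendsto_ofReal ?_
    simpa using (tendsto_one_div_atTop_nhds_zero_nat (𝕜 := ℝ)).const_add 1
  have h3 : liminf (fun n => expAverage φ F β (n + 1) x) atTop = lowerExpAverage φ F β x :=
    liminf_nat_add (fun n => expAverage φ F β n x) 1
  have h4 : lowerExpAverage φ F β (φ x) * ENNReal.ofReal (Real.exp (β * F x)) =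
      liminf (fun n : ℕ => ENNReal.ofReal (1 + 1 / (n : ℝ)) * expAverage φ F β (n + 1) x) atTop := by
    rw [lowerExpAverage, mul_comm, ← ENNReal.liminf_const_mul_of_ne_top ENNReal.ofReal_ne_top,
      ← ENNReal.liminf_add_of_right_tendsto_zero h1]
    refine liminf_congr ?_
    filter_upwards [eventually_ne_atTop 0] with n hn
    rw [← expAverage_comp φ F β hn x, mul_comm (expAverage _ _ _ _ _)]
    rfl
  rw [h4]
  refine le_antisymm ?_ ?_
  · refine (ENNReal.liminf_mul_le (Or.inl (by rw [h2.limsup_eq]; simp))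
      (Or.inl (by rw [h2.limsup_eq]; simp))).trans_eq ?_
    rw [h2.limsup_eq, one_mul, h3]
  · refine le_trans (le_of_eq ?_) ENNReal.le_liminf_mul
    rw [h2.liminf_eq, one_mul, h3]

lemma continuous_orbitSum_natCast (φ : X ≃ₜ X) {F : X → ℝ} (hF : Continuous F) (n : ℕ) :
    Continuous (orbitSum φ F (n : ℤ)) := by
  have : orbitSum φ F (n : ℤ) = fun x => ∑ j ∈ Finset.range n, F (φ^[j] x) := rfl
  rw [this]
  exact continuous_finsetSum _ fun j _ => hF.comp (φ.continuous.iterate j)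

variable [MeasurableSpace X] [BorelSpace X] {φ : X ≃ₜ X} {F : X → ℝ} {β : ℝ} {m : Measure X}

lemma measurable_expAverage (φ : X ≃ₜ X) (hF : Continuous F) (β : ℝ) (n : ℕ) :
    Measurable (expAverage φ F β n) := by
  have h : Continuous fun x =>
      (1 / (n : ℝ)) * ∑ j ∈ Finset.Icc 1 n, Real.exp (β * orbitSum φ F (j : ℤ) x) :=
    continuous_const.mul (continuous_finsetSum _ fun j _ =>
      Real.continuous_exp.comp (continuous_const.mul (continuous_orbitSum_natCast φ hF j)))
  exact h.measurable.ennreal_ofReal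

lemma measurable_lowerExpAverage (φ : X ≃ₜ X) (hF : Continuous F) (β : ℝ) :
    Measurable (lowerExpAverage φ F β) :=
  Measurable.liminf fun n => measurable_expAverage φ hF β n

lemma measurable_expWeight (hF : Continuous F) (β : ℝ) :
    Measurable fun x => ENNReal.ofReal (Real.exp (β * F x)) :=
  (Real.continuous_exp.comp (continuous_const.mul hF)).measurable.ennreal_ofReal

/-- Pushforward form of conformality, suited to change of variables and weak limits. -/
lemma isConformal_of_map_eq [IsProbabilityMeasure m]
    (h : (m.withDensity fun x => ENNReal.ofReal (Real.exp (β * F x))).map φ = m) :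
    IsConformal φ F β m where
  isProbabilityMeasure := inferInstance
  measure_image B hB := by
    have hB' : MeasurableSet (φ '' B) := φ.measurableEmbedding.measurableSet_image.2 hB
    conv_lhs => rw [← h]
    rw [Measure.map_apply φ.continuous.measurable hB', preimage_image_eq _ φ.injective,
      withDensity_apply _ hB]

lemma IsConformal.map_eq (hm : IsConformal φ F β m) :
    (m.withDensity fun x => ENNReal.ofReal (Real.exp (β * F x))).map φ = m := by
  ext B hB
  have hB' : MeasurableSet (φ ⁻¹' B) := φ.continuous.measurable hB
  rw [Measure.map_apply φ.continuous.measurable hB, withDensity_apply _ hB',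
    ← hm.measure_image _ hB', image_preimage_eq _ φ.surjective]

lemma IsConformal.lintegral_comp_mul (hm : IsConformal φ F β m) (hF : Continuous F)
    {g : X → ENNReal} (hg : Measurable g) :
    ∫⁻ x, g (φ x) * ENNReal.ofReal (Real.exp (β * F x)) ∂m = ∫⁻ x, g x ∂m := by
  conv_rhs => rw [← hm.map_eq]
  rw [lintegral_map hg φ.continuous.measurable,
    lintegral_withDensity_eq_lintegral_mul _ (measurable_expWeight hF β)
      (g := fun x => g (φ x)) (hg.comp φ.continuous.measurable)]
  simp [mul_comm]

lemma IsConformal.lintegral_exp_orbitSum (hm : IsConformal φ F β m) (hF : Continuous F) (n : ℕ) :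
    ∫⁻ x, ENNReal.ofReal (Real.exp (β * orbitSum φ F (n : ℤ) x)) ∂m = 1 := by
  have := hm.isProbabilityMeasure
  induction n with
  | zero =>
    have : ∀ x, orbitSum φ F ((0 : ℕ) : ℤ) x = 0 := fun x => by
      rw [orbitSum_natCast, Finset.sum_range_zero]
    simp only [this]
    simp
  | succ n ih =>
    rw [← ih, ← hm.lintegral_comp_mul hF
      (measurable_expWeight (continuous_orbitSum_natCast φ hF n) β)]
    refine lintegral_congr fun x => ?_
    rw [orbitSum_succ_left, ← ENNReal.ofReal_mul (by positivity), ← Real.exp_add]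
    ring_nf

lemma IsConformal.lintegral_expAverage (hm : IsConformal φ F β m) (hF : Continuous F) {n : ℕ}
    (hn : n ≠ 0) : ∫⁻ x, expAverage φ F β n x ∂m = 1 := by
  have h : ∀ x, expAverage φ F β n x = ENNReal.ofReal (1 / n) *
      ∑ j ∈ Finset.Icc 1 n, ENNReal.ofReal (Real.exp (β * orbitSum φ F (j : ℤ) x)) := by
    intro x
    rw [expAverage, ENNReal.ofReal_mul (by positivity),
      ENNReal.ofReal_sum_of_nonneg fun j _ => by positivity]
  have hmeas : ∀ j : ℕ, Measurable fun x =>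
      ENNReal.ofReal (Real.exp (β * orbitSum φ F (j : ℤ) x)) :=
    fun j => measurable_expWeight (continuous_orbitSum_natCast φ hF j) β
  simp only [h]
  rw [lintegral_const_mul _ (Finset.measurable_fun_sum _ fun j _ => hmeas j),
    lintegral_finsetSum _ fun j _ => hmeas j]
  simp only [hm.lintegral_exp_orbitSum hF]
  simp only [Finset.sum_const, Nat.card_Icc, add_tsub_cancel_right, nsmul_eq_mul, mul_one]
  rw [← ENNReal.ofReal_natCast n, ← ENNReal.ofReal_mul (by positivity), one_div,
    inv_mul_cancel₀ (by exact_mod_cast hn), ENNReal.ofReal_one]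

/-- Fatou, as every average has integral 1. In particular the lower average is finite a.e. -/
lemma IsConformal.lintegral_lowerExpAverage_le (hm : IsConformal φ F β m) (hF : Continuous F) :
    ∫⁻ x, lowerExpAverage φ F β x ∂m ≤ 1 := by
  refine (lintegral_liminf_le fun n => measurable_expAverage φ hF β n).trans_eq ?_
  refine Tendsto.liminf_eq (tendsto_const_nhds.congr' ?_)
  filter_upwards [eventually_ne_atTop 0] with n hn
  exact (hm.lintegral_expAverage hF hn).symm

/-- A conformal measure becomes invariant when weighted with the lower limit of the averages. -/
lemma IsConformal.map_withDensity_lowerExpAverage (hm : IsConformal φ F β m) (hF : Continuous F) :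
    (m.withDensity (lowerExpAverage φ F β)).map φ = m.withDensity (lowerExpAverage φ F β) := by
  ext B hB
  have hB' : MeasurableSet (φ ⁻¹' B) := φ.continuous.measurable hB
  rw [Measure.map_apply φ.continuous.measurable hB, withDensity_apply _ hB',
    withDensity_apply _ hB, ← lintegral_indicator hB, ← lintegral_indicator hB',
    ← hm.lintegral_comp_mul hF ((measurable_lowerExpAverage φ hF β).indicator hB)]
  refine lintegral_congr fun x => ?_
  by_cases hx : φ x ∈ B
  · rw [indicator_of_mem hx, indicator_of_mem (by exact hx), lowerExpAverage_comp]
  · rw [indicator_of_notMem hx, indicator_of_notMem (by exact hx), zero_mul]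

end general

/-! ### Unique ergodicity, densities and limits of conformal measures -/

section circle

variable {a : UnitAddCircle} {φ : UnitAddCircle ≃ₜ UnitAddCircle} {F : UnitAddCircle → ℝ} {β : ℝ}
  {m : Measure UnitAddCircle}

/-- The translations preserving ν form a subgroup containing the dense orbit of `a`; integrals of
translated continuous functions depend continuously on the translation. -/
lemma map_add_left_eq_of_denseRange (hd : DenseRange (· • a : ℤ → UnitAddCircle))
    (ν : Measure UnitAddCircle) [IsFiniteMeasure ν] (h : ν.map (a + ·) = ν) (t : UnitAddCircle) :
    ν.map (t + ·) = ν := by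
  let H : AddSubgroup UnitAddCircle :=
    { carrier := {t | ν.map (t + ·) = ν}
      zero_mem' := by simp
      add_mem' := fun {s t} hs ht => by
        have : (fun x => s + t + x) = (s + ·) ∘ (t + ·) := by ext x; simp [add_assoc]
        rw [mem_ofPred_eq, this, ← Measure.map_map (by fun_prop) (by fun_prop), ht, hs]
      neg_mem' := fun {s} hs => by
        rw [mem_ofPred_eq]
        conv_lhs => rw [← (show ν.map (s + ·) = ν from hs)]
        rw [Measure.map_map (by fun_prop) (by fun_prop)]
        have : (-s + ·) ∘ (s + ·) = (id : UnitAddCircle → UnitAddCircle) := by ext x; simp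
        rw [this, Measure.map_id] }
  have haH : ∀ n : ℤ, ν.map (n • a + ·) = ν := fun n => H.zsmul_mem (show a ∈ H from h) n
  refine ext_of_forall_integral_eq_of_IsFiniteMeasure fun f => ?_
  have hint : ∀ t, ∫ x, f x ∂(ν.map (t + ·)) = ∫ x, f (t + x) ∂ν := fun t =>
    integral_map (by fun_prop) f.continuous.aestronglyMeasurable
  rw [hint]
  have hcont : Continuous fun t => ∫ x, f (t + x) ∂ν := by
    refine continuous_of_dominated (bound := fun _ => ‖f‖) (fun t => ?_) (fun t => ?_) ?_ ?_
    · exact Continuous.aestronglyMeasurable (by fun_prop)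
    · exact Eventually.of_forall fun x => f.norm_coe_le_norm _
    · exact integrable_const _
    · exact Eventually.of_forall fun x => by fun_prop
  have heq : (fun t => ∫ x, f (t + x) ∂ν) = fun _ => ∫ x, f x ∂ν := by
    refine hd.equalizer hcont continuous_const ?_
    ext n
    simp only [Function.comp_apply]
    rw [← hint, haH]
  exact congrFun heq t

/-- Unique ergodicity of the rotations of infinite order. -/
lemma eq_smul_volume_of_map_rotation (hd : DenseRange (· • a : ℤ → UnitAddCircle))
    (ν : Measure UnitAddCircle) [IsFiniteMeasure ν] (h : ν.map (a + ·) = ν) :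
    ν = ν univ • (volume : Measure UnitAddCircle) := by
  have : ν.IsAddLeftInvariant := ⟨map_add_left_eq_of_denseRange hd ν h⟩
  have h1 := Measure.isAddLeftInvariant_eq_smul ν (volume : Measure UnitAddCircle)
  have h2 : ν univ = (Measure.addHaarScalarFactor ν (volume : Measure UnitAddCircle) : ENNReal) := by
    conv_lhs => rw [h1]
    simp
  rw [h2]
  exact h1

/-- A conformal measure of type `II₁` is determined up to a factor by the potential. -/
lemma IsConformal.exists_eq_smul_withDensity (hm : IsConformal φ F β m)
    (hφ : ∀ x, φ x = x + a) (hd : DenseRange (· • a : ℤ → UnitAddCircle)) (hF : Continuous F)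
    (h0 : ∀ᵐ x ∂m, 0 < lowerExpAverage φ F β x) :
    ∃ c : ENNReal, c ≠ 0 ∧ c ≠ ⊤ ∧
      m = c • volume.withDensity (fun x => (lowerExpAverage φ F β x)⁻¹) := by
  have := hm.isProbabilityMeasure
  set h := lowerExpAverage φ F β with hh
  have hmeas : Measurable h := measurable_lowerExpAverage φ hF β
  have hle : ∫⁻ x, h x ∂m ≤ 1 := hm.lintegral_lowerExpAverage_le hF
  have hfin : ∫⁻ x, h x ∂m ≠ ⊤ := ne_top_of_le_ne_top ENNReal.one_ne_top hle
  have htop : ∀ᵐ x ∂m, h x ≠ ⊤ := (ae_lt_top hmeas hfin).mono fun x hx => hx.ne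
  have : IsFiniteMeasure (m.withDensity h) := isFiniteMeasure_withDensity hfin
  have hφ' : (a + ·) = φ := by ext x; rw [hφ, add_comm]
  have hν := eq_smul_volume_of_map_rotation hd (m.withDensity h)
    (by rw [hφ']; exact hm.map_withDensity_lowerExpAverage hF)
  refine ⟨m.withDensity h univ, ?_, measure_ne_top _ _, ?_⟩
  · rw [withDensity_apply _ MeasurableSet.univ, Measure.restrict_univ]
    intro hz
    rw [lintegral_eq_zero_iff hmeas] at hz
    have : ∀ᵐ x ∂m, False := by
      filter_upwards [h0, hz] with x h1 h2
      exact h1.ne' h2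
    rw [eventually_false_iff_eq_bot, ae_eq_bot] at this
    exact IsProbabilityMeasure.ne_zero m this
  · have hinv := withDensity_inv_same hmeas (h0.mono fun x hx => hx.ne') htop
    conv_lhs => rw [← hinv, hν]
    rw [withDensity_smul_measure]

lemma IsTypeIIOne.ae_pos (hm : IsTypeIIOne φ F β m) [IsProbabilityMeasure m] (hF : Continuous F) :
    ∀ᵐ x ∂m, 0 < lowerExpAverage φ F β x := by
  have h1 : m {x | 0 < lowerExpAverage φ F β x} = 1 := by
    refine le_antisymm prob_le_one ?_
    rw [← show m (typeIIOneSet φ F β) = 1 from hm, typeIIOneSet_eq]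
    exact measure_mono sdiff_subset
  exact (prob_compl_eq_zero_iff
    (measurableSet_lt measurable_const (measurable_lowerExpAverage φ hF β))).2 h1

lemma IsConformal.eq_of_isTypeIIOne {m' : Measure UnitAddCircle} (hm : IsConformal φ F β m)
    (hm' : IsConformal φ F β m') (hφ : ∀ x, φ x = x + a)
    (hd : DenseRange (· • a : ℤ → UnitAddCircle)) (hF : Continuous F)
    (h : IsTypeIIOne φ F β m) (h' : IsTypeIIOne φ F β m') : m = m' := by
  have hp := hm.isProbabilityMeasure
  have hp' := hm'.isProbabilityMeasure
  obtain ⟨c, -, -, hc⟩ := hm.exists_eq_smul_withDensity hφ hd hF (h.ae_pos hF)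
  obtain ⟨c', -, -, hc'⟩ := hm'.exists_eq_smul_withDensity hφ hd hF (h'.ae_pos hF)
  set μ := (volume : Measure UnitAddCircle).withDensity fun x => (lowerExpAverage φ F β x)⁻¹
  have h1 : c * μ univ = 1 := by rw [← smul_eq_mul, ← Measure.smul_apply, ← hc, measure_univ]
  have h2 : c' * μ univ = 1 := by rw [← smul_eq_mul, ← Measure.smul_apply, ← hc', measure_univ]
  rw [hc, hc', ENNReal.eq_inv_of_mul_eq_one_left h1, ENNReal.eq_inv_of_mul_eq_one_left h2]

/-- The conformal measure attached to a solution of the cohomological equation. -/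
lemma isConformal_smul_withDensity (hφ : ∀ x, φ x = x + a) (hF : Continuous F)
    {w : UnitAddCircle → ℝ} (hw : Measurable w) (hFw : ∀ᵐ x, F x = w x - w (x + a))
    (h0 : ∫⁻ x, ENNReal.ofReal (Real.exp (-β * w x)) ≠ 0)
    (htop : ∫⁻ x, ENNReal.ofReal (Real.exp (-β * w x)) ≠ ⊤) :
    IsConformal φ F β ((∫⁻ x, ENNReal.ofReal (Real.exp (-β * w x)))⁻¹ •
      volume.withDensity fun x => ENNReal.ofReal (Real.exp (-β * w x))) := by
  set ρ : UnitAddCircle → ENNReal := fun x => ENNReal.ofReal (Real.exp (-β * w x)) with hρ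
  have hρm : Measurable ρ := by fun_prop
  set Z := ∫⁻ x, ρ x with hZ
  have : IsProbabilityMeasure (Z⁻¹ • volume.withDensity ρ) := by
    refine ⟨?_⟩
    rw [Measure.smul_apply, withDensity_apply _ MeasurableSet.univ, Measure.restrict_univ,
      smul_eq_mul, ENNReal.inv_mul_cancel h0 htop]
  have hpres : MeasurePreserving φ (volume : Measure UnitAddCircle) volume := by
    have : ⇑φ = (· + a) := funext hφ
    rw [this]
    exact measurePreserving_add_right volume a
  refine isConformal_of_map_eq ?_
  rw [withDensity_smul_measure, Measure.map_smul,
    ← withDensity_mul _ hρm (measurable_expWeight hF β)]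
  congr 1
  ext B hB
  have hB' : MeasurableSet (φ ⁻¹' B) := φ.continuous.measurable hB
  rw [Measure.map_apply φ.continuous.measurable hB, withDensity_apply _ hB',
    withDensity_apply _ hB, ← hpres.setLIntegral_comp_preimage hB hρm]
  refine setLIntegral_congr_fun_ae hB' ?_
  filter_upwards [hFw] with x hx _
  rw [Pi.mul_apply, hρ, hφ]
  simp only
  rw [← ENNReal.ofReal_mul (by positivity), ← Real.exp_add, hx]
  ring_nf

/-- Conformal measures persist under uniform limits of the potential. -/
lemma exists_isConformal_of_tendsto {G : C(UnitAddCircle, ℝ)} {Gs : ℕ → C(UnitAddCircle, ℝ)}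
    (hG : Tendsto Gs atTop (𝓝 G)) {ms : ℕ → Measure UnitAddCircle}
    (hms : ∀ k, IsConformal φ (Gs k) β (ms k)) :
    ∃ m, IsConformal φ G β m := by
  let P : ℕ → ProbabilityMeasure UnitAddCircle := fun k => ⟨ms k, (hms k).isProbabilityMeasure⟩
  -- An ultrafilter finer than `atTop` replaces a convergent subsequence in the compact space of
  -- probability measures.
  let U : Ultrafilter ℕ := Ultrafilter.of atTop
  have hU : (U : Filter ℕ) ≤ atTop := Ultrafilter.of_le atTop
  obtain ⟨p, -, hp⟩ := isCompact_univ.ultrafilter_le_nhds (U.map P) (by simp)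
  have hp' : Tendsto P U (𝓝 p) := hp
  rw [ProbabilityMeasure.tendsto_iff_forall_integral_tendsto] at hp'
  refine ⟨p, isConformal_of_map_eq ?_⟩
  have hint : ∀ (q : ProbabilityMeasure UnitAddCircle) (H f : C(UnitAddCircle, ℝ)),
      ∫ x, f x ∂(((q : Measure UnitAddCircle).withDensity
        fun x => ENNReal.ofReal (Real.exp (β * H x))).map φ) =
      ∫ x, f (φ x) * Real.exp (β * H x) ∂(q : Measure UnitAddCircle) := by
    intro q H f
    rw [integral_map φ.continuous.measurable.aemeasurable f.continuous.aestronglyMeasurable,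
      integral_withDensity_eq_integral_toReal_smul (measurable_expWeight H.continuous β)
        (by simp)]
    refine integral_congr_ae (Eventually.of_forall fun x => ?_)
    simp only [ENNReal.toReal_ofReal (Real.exp_pos _).le, smul_eq_mul, mul_comm]
  have hfin : IsFiniteMeasure ((p : Measure UnitAddCircle).withDensity
      fun x => ENNReal.ofReal (Real.exp (β * G x))) := by
    have hb : Integrable (fun x => Real.exp (β * G x)) (p : Measure UnitAddCircle) :=
      (BoundedContinuousFunction.mkOfCompact
        ⟨fun x => Real.exp (β * G x), by fun_prop⟩).integrable _
    exact isFiniteMeasure_withDensity_ofReal hb.2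
  refine ext_of_forall_integral_eq_of_IsFiniteMeasure fun f => ?_
  refine (hint p G f.toContinuousMap).trans ?_
  -- The weighted test function depends continuously on the potential in sup norm, so the potential
  -- and the measure can vary together.
  let T : C(UnitAddCircle, ℝ) → C(UnitAddCircle, ℝ) := fun H =>
    f.toContinuousMap.comp ⟨φ, φ.continuous⟩ *
      (ContinuousMap.mk (fun t : ℝ => Real.exp (β * t)) (by fun_prop)).comp H
  have hTc : Continuous T := by
    refine continuous_const.mul ?_
    exact ContinuousMap.continuous_postcomp _
  have hTapp : ∀ H x, T H x = f (φ x) * Real.exp (β * H x) := fun H x => rfl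
  have h1 : Tendsto (fun k => ∫ x, T G x ∂(P k : Measure UnitAddCircle)) U
      (𝓝 (∫ x, T G x ∂(p : Measure UnitAddCircle))) :=
    hp' (BoundedContinuousFunction.mkOfCompact (T G))
  have h2 : Tendsto (fun k => ∫ x, f x ∂(P k : Measure UnitAddCircle)) U
      (𝓝 (∫ x, f x ∂(p : Measure UnitAddCircle))) := hp' f
  have h3 : Tendsto (fun k => ∫ x, T (Gs k) x ∂(P k : Measure UnitAddCircle) -
      ∫ x, T G x ∂(P k : Measure UnitAddCircle)) U (𝓝 0) := by
    have h4 : Tendsto (fun k => ‖T (Gs k) - T G‖) U (𝓝 0) := by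
      have : Tendsto (fun k => T (Gs k)) U (𝓝 (T G)) := (hTc.tendsto G).comp (hG.mono_left hU)
      exact (tendsto_iff_norm_sub_tendsto_zero).1 this
    refine squeeze_zero_norm (fun k => ?_) h4
    have hi : ∀ H : C(UnitAddCircle, ℝ), Integrable H (P k : Measure UnitAddCircle) := fun H =>
      (BoundedContinuousFunction.mkOfCompact H).integrable _
    rw [← integral_sub (hi _) (hi _)]
    have := norm_integral_le_of_norm_le_const (μ := (P k : Measure UnitAddCircle))
      (f := fun x => T (Gs k) x - T G x) (C := ‖T (Gs k) - T G‖)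
      (Eventually.of_forall fun x => (T (Gs k) - T G).norm_coe_le_norm x)
    simpa using this
  have h5 : ∀ k, ∫ x, T (Gs k) x ∂(P k : Measure UnitAddCircle) =
      ∫ x, f x ∂(P k : Measure UnitAddCircle) := by
    intro k
    have h6 := hint (P k) (Gs k) f.toContinuousMap
    rw [show ((P k : Measure UnitAddCircle).withDensity fun x =>
      ENNReal.ofReal (Real.exp (β * Gs k x))).map φ = P k from (hms k).map_eq] at h6
    exact h6.symm
  simp only [h5] at h3
  have h7 := h3.add h1
  simp only [sub_add_cancel, zero_add] at h7
  exact tendsto_nhds_unique h7 h2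

end circle

/-! ### Maximal ergodic theorem -/

section maximal

variable {X : Type*} {T : X → X} {f : X → ℝ}

/-- The maximum of the Birkhoff sums `∑_{j < n} f ∘ T^j` over `n ≤ N`. -/
noncomputable def maximalSum (T : X → X) (f : X → ℝ) : ℕ → X → ℝ
  | 0, _ => 0
  | N + 1, x => max 0 (f x + maximalSum T f N (T x))

lemma maximalSum_le_succ (N : ℕ) (x : X) : maximalSum T f N x ≤ maximalSum T f (N + 1) x := by
  induction N generalizing x with
  | zero => exact le_max_left _ _
  | succ N ih => exact max_le_max le_rfl (by linarith [ih (T x)])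

lemma maximalSum_nonneg (N : ℕ) (x : X) : 0 ≤ maximalSum T f N x := by
  cases N with
  | zero => exact le_rfl
  | succ N => exact le_max_left _ _

lemma sum_le_maximalSum (N : ℕ) (x : X) :
    ∑ j ∈ Finset.range N, f (T^[j] x) ≤ maximalSum T f N x := by
  induction N generalizing x with
  | zero => exact le_rfl
  | succ N ih =>
    rw [Finset.sum_range_succ', add_comm]
    exact (add_le_add le_rfl (ih (T x))).trans (le_max_right _ _)

variable [MeasurableSpace X] {μ : Measure X}

lemma measurable_maximalSum (hT : Measurable T) (hf : Measurable f) (N : ℕ) :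
    Measurable (maximalSum T f N) := by
  induction N with
  | zero => exact measurable_const
  | succ N ih => exact measurable_const.max (hf.add (ih.comp hT))

lemma integrable_maximalSum (hT : MeasurePreserving T μ μ) (hf : Integrable f μ) (N : ℕ) :
    Integrable (maximalSum T f N) μ := by
  induction N with
  | zero => exact integrable_zero _ _ _
  | succ N ih => exact (integrable_zero _ _ _).sup (hf.add (hT.integrable_comp_of_integrable ih))

/-- The maximal ergodic theorem. -/
lemma setIntegral_maximalSum_pos_nonneg (hT : MeasurePreserving T μ μ) (hfm : Measurable f)
    (hf : Integrable f μ) (N : ℕ) : 0 ≤ ∫ x in {x | 0 < maximalSum T f (N + 1) x}, f x ∂μ := by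
  set M := maximalSum T f (N + 1) with hM
  have hMm : Measurable M := measurable_maximalSum hT.measurable hfm _
  have hMi : Integrable M μ := integrable_maximalSum hT hf _
  have hMTi : Integrable (fun x => M (T x)) μ := hT.integrable_comp_of_integrable hMi
  set D := {x | 0 < M x} with hD
  have hDm : MeasurableSet D := measurableSet_lt measurable_const hMm
  have h1 : ∫ x, M x - M (T x) ∂μ = 0 := by
    have h2 : ∫ x, M (T x) ∂μ = ∫ x, M x ∂μ := by
      have := integral_map (μ := μ) hT.measurable.aemeasurable (f := M)
        (hMm.aestronglyMeasurable)
      rw [hT.map_eq] at this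
      exact this.symm
    rw [integral_sub hMi hMTi, h2, sub_self]
  rw [← h1, ← integral_indicator hDm]
  -- Pointwise M - M ∘ T ≤ f·1_D, while the left side integrates to zero by invariance.
  refine integral_mono (hMi.sub hMTi) (hf.indicator hDm) fun x => ?_
  by_cases hx : x ∈ D
  · rw [indicator_of_mem hx]
    have h3 : M x = f x + maximalSum T f N (T x) := by
      have hx' : 0 < max 0 (f x + maximalSum T f N (T x)) := hx
      exact max_eq_right ((lt_max_iff.1 hx').resolve_left (lt_irrefl 0)).le
    have h4 : maximalSum T f N (T x) ≤ M (T x) := maximalSum_le_succ N (T x)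
    simp only
    linarith
  · rw [indicator_of_notMem hx]
    have h3 : M x ≤ 0 := not_lt.1 hx
    have h4 : 0 ≤ M (T x) := maximalSum_nonneg _ _
    simp only
    linarith

/-- The maximal inequality for visits to a set. -/
lemma measure_exists_lt_visits_le [IsFiniteMeasure μ] (hT : MeasurePreserving T μ μ) {E : Set X}
    (hE : MeasurableSet E) :
    μ {x | ∃ n : ℕ, (n : ℝ) / 2 < ∑ j ∈ Finset.range n, E.indicator 1 (T^[j] x)} ≤ 2 * μ E := by
  -- A positive Birkhoff sum of this `f` means that more than half of the times are visits to `E`.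
  set f : X → ℝ := fun x => E.indicator 1 x - 1 / 2 with hf
  have hind : Measurable (E.indicator (1 : X → ℝ)) := measurable_one.indicator hE
  have hindi : Integrable (E.indicator (1 : X → ℝ)) μ := (integrable_const (1 : ℝ)).indicator hE
  have hfm : Measurable f := hind.sub_const _
  have hfi : Integrable f μ := hindi.sub (integrable_const _)
  have hmono : Monotone fun N => {x | 0 < maximalSum T f (N + 1) x} :=
    monotone_nat_of_le_succ fun N x hx => lt_of_lt_of_le hx (maximalSum_le_succ _ _)
  calc μ {x | ∃ n : ℕ, (n : ℝ) / 2 < ∑ j ∈ Finset.range n, E.indicator 1 (T^[j] x)}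
      ≤ μ (⋃ N, {x | 0 < maximalSum T f (N + 1) x}) := by
        refine measure_mono fun x ⟨n, hn⟩ => mem_iUnion.2 ⟨n, ?_⟩
        have h1 := (sum_le_maximalSum (T := T) (f := f) n x).trans (maximalSum_le_succ n x)
        refine lt_of_lt_of_le ?_ h1
        simp only [hf, Finset.sum_sub_distrib, Finset.sum_const, Finset.card_range, nsmul_eq_mul]
        linarith
    _ = ⨆ N, μ {x | 0 < maximalSum T f (N + 1) x} := hmono.measure_iUnion
    _ ≤ 2 * μ E := by
        refine iSup_le fun N => ?_
        have h := setIntegral_maximalSum_pos_nonneg hT hfm hfi N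
        set D := {x | 0 < maximalSum T f (N + 1) x} with hD
        rw [hf, integral_sub hindi.integrableOn (integrable_const _).integrableOn,
          integral_indicator_one hE, setIntegral_const, measureReal_restrict_apply hE] at h
        have h2 : μ.real (E ∩ D) ≤ μ.real E := measureReal_mono inter_subset_left
        rw [smul_eq_mul] at h
        have h3 : μ.real D ≤ 2 * μ.real E := by linarith
        rw [← ofReal_measureReal (s := D), ← ofReal_measureReal (s := E),
          ← ENNReal.ofReal_ofNat 2, ← ENNReal.ofReal_mul (by norm_num)]
        exact ENNReal.ofReal_le_ofReal h3

end maximal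

/-! ### Positivity of the lower average for β ≥ 0 -/

section positivity

variable {a : UnitAddCircle} {v : ℕ → C(UnitAddCircle, ℝ)} {φ : UnitAddCircle ≃ₜ UnitAddCircle}
  {β : ℝ}

/-- In Σ (v_k(x) - v_k(φ^j x)) the terms with k ≥ K are nonnegative, and the others are at least
-‖v_k‖. -/
lemma IsSpikeSequence.neg_sum_norm_le_orbitSum (hv : IsSpikeSequence a v)
    (hφ : ∀ x, φ x = x + a) {K j : ℕ} {x : UnitAddCircle}
    (hx : ∀ k, K ≤ k → v k (φ^[j] x) = 0) :
    -∑ k ∈ Finset.range K, ‖v k‖ ≤ orbitSum φ (coboundarySum a v) (j : ℤ) x := by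
  have h1 : HasSum (fun k => if k ∈ Finset.range K then -‖v k‖ else 0)
      (∑ k ∈ Finset.range K, -‖v k‖) := by
    rw [← Finset.sum_congr rfl fun k hk => if_pos (c := k ∈ Finset.range K) hk]
    exact hasSum_sum_of_ne_finset_zero fun k hk => if_neg hk
  rw [← Finset.sum_neg_distrib]
  refine hasSum_le (fun k => ?_) h1 (hv.hasSum_orbitSum hφ j x)
  rw [iterate_rotation hφ] at hx
  have h0 := hv.nonneg k x
  split_ifs with hk
  · have := (le_abs_self _).trans ((v k).norm_coe_le_norm (x + j • a))
    linarith
  · rw [hx k (by simpa using hk)]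
    linarith

lemma IsSpikeSequence.lowerExpAverage_pos_of_visits (hv : IsSpikeSequence a v)
    (hφ : ∀ x, φ x = x + a) (hβ : 0 ≤ β) {K : ℕ} {x : UnitAddCircle}
    (hx : ∀ n : ℕ, ∑ j ∈ Finset.range n,
      (⋃ k ∈ Ici K, {y | v k y ≠ 0}).indicator (1 : UnitAddCircle → ℝ) (φ^[j] x) ≤ (n : ℝ) / 2) :
    0 < lowerExpAverage φ (coboundarySum a v) β x := by
  set E := ⋃ k ∈ Ici K, {y | v k y ≠ 0} with hE
  set c := Real.exp (-(β * ∑ k ∈ Finset.range K, ‖v k‖)) with hc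
  have hcpos : 0 < c := Real.exp_pos _
  have hterm : ∀ j : ℕ, c * (1 - E.indicator (1 : UnitAddCircle → ℝ) (φ^[j] x)) ≤
      Real.exp (β * orbitSum φ (coboundarySum a v) (j : ℤ) x) := by
    intro j
    by_cases hj : φ^[j] x ∈ E
    · rw [indicator_of_mem hj]
      simp [Real.exp_nonneg]
    · rw [indicator_of_notMem hj, sub_zero, mul_one, hc, Real.exp_le_exp, ← mul_neg]
      refine mul_le_mul_of_nonneg_left (hv.neg_sum_norm_le_orbitSum hφ fun k hk => ?_) hβ
      by_contra h
      exact hj (mem_biUnion (mem_Ici.2 hk) h)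
  -- At least n - (n + 1)/2 ≥ n/4 of the times 1, …, n avoid `E`, once n ≥ 2; `hx` is used at n + 1
  -- because it also counts time 0.
  refine lt_of_lt_of_le (b := ENNReal.ofReal (c / 4)) (ENNReal.ofReal_pos.2 (by positivity)) ?_
  refine le_liminf_of_le (by isBoundedDefault) ?_
  filter_upwards [eventually_ge_atTop 2] with n hn
  refine ENNReal.ofReal_le_ofReal ?_
  have hn' : (2 : ℝ) ≤ n := by exact_mod_cast hn
  have hsub : ∑ j ∈ Finset.Icc 1 n, E.indicator (1 : UnitAddCircle → ℝ) (φ^[j] x) ≤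
      ((n + 1 : ℕ) : ℝ) / 2 := by
    refine le_trans (Finset.sum_le_sum_of_subset_of_nonneg ?_ fun j _ _ => ?_) (hx (n + 1))
    · intro j hj
      simp only [Finset.mem_Icc, Finset.mem_range] at *
      omega
    · exact indicator_nonneg (fun _ _ => zero_le_one) _
  have hsum : c * (n - ((n + 1 : ℕ) : ℝ) / 2) ≤
      ∑ j ∈ Finset.Icc 1 n, Real.exp (β * orbitSum φ (coboundarySum a v) (j : ℤ) x) := by
    refine le_trans ?_ (Finset.sum_le_sum fun j _ => hterm j)
    rw [← Finset.mul_sum, Finset.sum_sub_distrib]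
    simp only [Finset.sum_const, Nat.card_Icc, add_tsub_cancel_right, nsmul_eq_mul, mul_one]
    gcongr
  rw [one_div, ← div_eq_inv_mul, le_div_iff₀ (by linarith)]
  refine le_trans ?_ hsum
  push_cast
  nlinarith

/-- Points failing the visit bound for K have measure at most 2 vol(E_K), which tends to 0 as a tail
of a convergent series. -/
lemma IsSpikeSequence.ae_lowerExpAverage_pos (hv : IsSpikeSequence a v)
    (hφ : ∀ x, φ x = x + a) (hβ : 0 ≤ β) :
    ∀ᵐ x, 0 < lowerExpAverage φ (coboundarySum a v) β x := by
  set E : ℕ → Set UnitAddCircle := fun K => ⋃ k ∈ Ici K, {y | v k y ≠ 0} with hE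
  have hEm : ∀ K, MeasurableSet (E K) := fun K =>
    MeasurableSet.biUnion (to_countable _) fun k _ =>
      ((v k).continuous.measurable (measurableSet_singleton 0)).compl
  have hpres : MeasurePreserving φ (volume : Measure UnitAddCircle) volume := by
    have : ⇑φ = (· + a) := funext hφ
    rw [this]
    exact measurePreserving_add_right volume a
  have hfin : ∑' k, volume {x | v k x ≠ 0} ≠ ⊤ := by
    refine ne_top_of_le_ne_top ?_ (ENNReal.tsum_le_tsum hv.volume_ne_zero_le)
    rw [← ENNReal.ofReal_tsum_of_nonneg (fun k => by positivity) (summable_half_pow.mul_left 2)]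
    exact ENNReal.ofReal_ne_top
  have htail : Tendsto (fun K => 2 * volume (E K)) atTop (𝓝 0) := by
    have h1 : Tendsto (fun K => 2 * ∑' k, volume {x | v (k + K) x ≠ 0}) atTop (𝓝 0) := by
      have := ENNReal.Tendsto.const_mul (a := 2)
        (ENNReal.tendsto_sum_nat_add (fun k => volume {x | v k x ≠ 0}) hfin) (Or.inr (by simp))
      simpa using this
    refine tendsto_of_tendsto_of_tendsto_of_le_of_le tendsto_const_nhds h1
      (fun _ => zero_le) fun K => ?_
    refine mul_le_mul_right ?_ _
    refine le_trans (measure_mono ?_) (measure_iUnion_le _)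
    intro x hx
    simp only [hE, mem_iUnion, mem_Ici] at hx
    obtain ⟨k, hk, hx⟩ := hx
    refine mem_iUnion.2 ⟨k - K, ?_⟩
    rwa [Nat.sub_add_cancel hk]
  rw [ae_iff]
  refine le_antisymm (ge_of_tendsto' htail fun K => ?_) (zero_le)
  refine le_trans (measure_mono fun x hx => ?_) (measure_exists_lt_visits_le hpres (hEm K))
  by_contra h
  refine hx (hv.lowerExpAverage_pos_of_visits hφ hβ (K := K) fun n => ?_)
  by_contra hn
  exact h ⟨n, not_le.1 hn⟩

end positivity

lemma lintegral_exp_ne_zero {g : UnitAddCircle → ℝ} (hg : Measurable g) :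
    ∫⁻ x, ENNReal.ofReal (Real.exp (g x)) ≠ 0 := by
  rw [Ne, lintegral_eq_zero_iff (by fun_prop)]
  intro h
  have : ∀ᵐ _ : UnitAddCircle, False := by
    filter_upwards [h] with x hx
    exact (ENNReal.ofReal_pos.2 (Real.exp_pos (g x))).ne' hx
  rw [eventually_false_iff_eq_bot, ae_eq_bot] at this
  simpa [this] using UnitAddCircle.measure_univ

/-! ### Conformal measures of the potential -/

namespace IsSpikeSequence

variable {a : UnitAddCircle} {v : ℕ → C(UnitAddCircle, ℝ)} {φ : UnitAddCircle ≃ₜ UnitAddCircle}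
  {β : ℝ} {m : Measure UnitAddCircle}

/-- Partial sums are coboundaries of continuous functions, so they have explicit conformal measures
for every β; the potential is their uniform limit. -/
lemma exists_isConformal (hv : IsSpikeSequence a v) (hφ : ∀ x, φ x = x + a) (β : ℝ) :
    ∃ m, IsConformal φ (coboundarySum a v) β m := by
  let f : ℕ → C(UnitAddCircle, ℝ) := fun k => v k - (v k).comp ⟨(· + a), by fun_prop⟩
  have hf : ∀ k x, f k x = v k x - v k (x + a) := fun k x => rfl
  have hsum : Summable f := Summable.of_norm_bounded summable_half_pow fun k =>
    (ContinuousMap.norm_le _ (by positivity)).2 fun x => hv.abs_sub_le k x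
  have hlim : ⇑(∑' k, f k) = coboundarySum a v := by
    ext x
    exact (ContinuousMap.tsum_apply hsum x).symm
  rw [← hlim]
  have hpart : ∀ K, ∃ m, IsConformal φ (∑ k ∈ Finset.range K, f k : C(UnitAddCircle, ℝ)) β m := by
    intro K
    have hw : Continuous fun x => ∑ k ∈ Finset.range K, v k x := by fun_prop
    refine ⟨_, isConformal_smul_withDensity hφ (ContinuousMap.continuous _) hw.measurable
      (Eventually.of_forall fun x => ?_) (lintegral_exp_ne_zero (by fun_prop)) ?_⟩
    · simp [hf, ContinuousMap.sum_apply]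
    · have hint : Integrable (fun x => Real.exp (-β * ∑ k ∈ Finset.range K, v k x))
          (volume : Measure UnitAddCircle) :=
        (BoundedContinuousFunction.mkOfCompact
          ⟨fun x => Real.exp (-β * ∑ k ∈ Finset.range K, v k x), by fun_prop⟩).integrable _
      exact hint.lintegral_lt_top.ne
  choose ms hms using hpart
  exact exists_isConformal_of_tendsto hsum.hasSum.tendsto_sum_nat hms

lemma measurable_tsum (v : ℕ → C(UnitAddCircle, ℝ)) : Measurable fun x => ∑' k, v k x :=
  Measurable.tsum fun k => (v k).continuous.measurable

lemma ae_coboundarySum_eq (hv : IsSpikeSequence a v) :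
    ∀ᵐ x, coboundarySum a v x = ∑' k, v k x - ∑' k, v k (x + a) := by
  filter_upwards [hv.ae_summable] with x hx
  exact hx.tsum_sub ((hv.summable_add_iff x).2 hx)

lemma lintegral_exp_tsum_eq_top (hv : IsSpikeSequence a v) {ε : ℝ} (hε : 0 < ε) :
    ∫⁻ x, ENNReal.ofReal (Real.exp (ε * ∑' k, v k x)) = ⊤ := by
  have h1 : ∀ k : ℕ, ENNReal.ofReal (ε * 2 ^ k / 2) ≤
      ∫⁻ x, ENNReal.ofReal (Real.exp (ε * ∑' k, v k x)) := by
    intro k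
    refine (hv.le_lintegral_exp k ε hε).trans (lintegral_mono_ae ?_)
    filter_upwards [hv.ae_summable] with x hx
    refine ENNReal.ofReal_le_ofReal (Real.exp_le_exp.2 (mul_le_mul_of_nonneg_left ?_ hε.le))
    exact hx.le_tsum k fun j _ => hv.nonneg j x
  have h2 : Tendsto (fun k : ℕ => ENNReal.ofReal (ε * 2 ^ k / 2)) atTop (𝓝 ⊤) :=
    ENNReal.tendsto_ofReal_atTop.comp (((tendsto_pow_atTop_atTop_of_one_lt
      (by norm_num : (1 : ℝ) < 2)).const_mul_atTop hε).atTop_div_const two_pos)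
  exact top_le_iff.1 (le_of_tendsto' h2 h1)

lemma isTypeIIOne_of_absolutelyContinuous (hv : IsSpikeSequence a v) (hφ : ∀ x, φ x = x + a)
    (ha : addOrderOf a = 0) (hβ : 0 ≤ β) [IsProbabilityMeasure m] (hm : m ≪ volume) :
    IsTypeIIOne φ (coboundarySum a v) β m := by
  rw [IsTypeIIOne, typeIIOneSet_eq, hv.typeISet_eq_empty hφ ha, sdiff_empty]
  refine (prob_compl_eq_zero_iff (measurableSet_lt measurable_const
    (measurable_lowerExpAverage φ hv.continuous_coboundarySum β))).1 ?_
  exact hm.ae_le (hv.ae_lowerExpAverage_pos hφ hβ)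

lemma preErgodic_of_absolutelyContinuous (hφ : ∀ x, φ x = x + a) (ha : addOrderOf a = 0)
    (hm : m ≪ volume) : PreErgodic φ m := by
  have h : Ergodic φ (volume : Measure UnitAddCircle) := by
    have : ⇑φ = (· + a) := funext hφ
    rw [this]
    exact AddCircle.ergodic_add_right.2 ha
  exact ⟨fun s hs hs' => (h.aeconst_set hs hs').anti hm.ae_le⟩

lemma existsUnique_isTypeIIOne (hv : IsSpikeSequence a v) (hφ : ∀ x, φ x = x + a)
    (hd : DenseRange (· • a : ℤ → UnitAddCircle)) (ha : addOrderOf a = 0) (hβ : 0 ≤ β) :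
    ∃! m : Measure UnitAddCircle, IsConformal φ (coboundarySum a v) β m ∧ PreErgodic φ m ∧
      IsTypeIIOne φ (coboundarySum a v) β m := by
  have hw := measurable_tsum v
  have hconf := isConformal_smul_withDensity (β := β) hφ hv.continuous_coboundarySum hw
    hv.ae_coboundarySum_eq (lintegral_exp_ne_zero (by fun_prop)) (by
      refine ne_top_of_le_ne_top (b := 1) ENNReal.one_ne_top ?_
      calc ∫⁻ x, ENNReal.ofReal (Real.exp (-β * ∑' k, v k x)) ≤ ∫⁻ _ : UnitAddCircle, 1 := by
            refine lintegral_mono fun x => ?_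
            rw [ENNReal.ofReal_le_one, Real.exp_le_one_iff]
            exact mul_nonpos_of_nonpos_of_nonneg (by linarith)
              (tsum_nonneg fun k => hv.nonneg k x)
        _ = 1 := by simp)
  have hac := (withDensity_absolutelyContinuous (volume : Measure UnitAddCircle)
    fun x => ENNReal.ofReal (Real.exp (-β * ∑' k, v k x))).smul_left
    (∫⁻ x, ENNReal.ofReal (Real.exp (-β * ∑' k, v k x)))⁻¹
  have := hconf.isProbabilityMeasure
  refine ⟨_, ⟨hconf, preErgodic_of_absolutelyContinuous hφ ha hac,
    hv.isTypeIIOne_of_absolutelyContinuous hφ ha hβ hac⟩, fun m' hm' => ?_⟩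
  exact hm'.1.eq_of_isTypeIIOne hconf hφ hd hv.continuous_coboundarySum hm'.2.2
    (hv.isTypeIIOne_of_absolutelyContinuous hφ ha hβ hac)

lemma not_ae_lowerExpAverage_pos (hv : IsSpikeSequence a v) (hφ : ∀ x, φ x = x + a)
    (hd : DenseRange (· • a : ℤ → UnitAddCircle)) (ha : addOrderOf a = 0) (hβ : β < 0)
    (hm : IsConformal φ (coboundarySum a v) β m) :
    ¬ ∀ᵐ x ∂m, 0 < lowerExpAverage φ (coboundarySum a v) β x := by
  intro hpos
  have hF := hv.continuous_coboundarySum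
  have := hm.isProbabilityMeasure
  obtain ⟨c, hc0, -, hmc⟩ := hm.exists_eq_smul_withDensity hφ hd hF hpos
  set h := lowerExpAverage φ (coboundarySum a v) β with hh
  have hmeas : Measurable h := measurable_lowerExpAverage φ hF β
  let w : UnitAddCircle → ℝ := fun x => ∑' k, v k x
  have hw : Measurable w := measurable_tsum v
  let e : UnitAddCircle → ENNReal := fun x => ENNReal.ofReal (Real.exp (-β * w x))
  have he : Measurable e := by fun_prop
  have he0 : ∀ x, e x ≠ 0 := fun x => (ENNReal.ofReal_pos.2 (Real.exp_pos _)).ne'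
  have hetop : ∀ x, e x ≠ ⊤ := fun x => ENNReal.ofReal_ne_top
  have hc1 : c * ∫⁻ x, (h x)⁻¹ = 1 := by
    have h1 : m univ = 1 := measure_univ
    rw [hmc, Measure.smul_apply, withDensity_apply _ MeasurableSet.univ,
      Measure.restrict_univ, smul_eq_mul] at h1
    exact h1
  have herg : Ergodic φ (volume : Measure UnitAddCircle) := by
    have : ⇑φ = (· + a) := funext hφ
    rw [this]
    exact AddCircle.ergodic_add_right.2 ha
  -- The cocycles of h and of e^{-βw} are mutually inverse, so the product is invariant, hence a.e.
  -- a constant `C`.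
  have hinv : (fun x => h x * e x) ∘ φ =ᵐ[volume] fun x => h x * e x := by
    filter_upwards [hv.ae_coboundarySum_eq] with x hx
    rw [Function.comp_apply, show h x = h (φ x) * _ from
      (lowerExpAverage_comp φ (coboundarySum a v) β x).symm, mul_assoc, hx, hφ]
    congr 1
    simp only [e, w]
    rw [← ENNReal.ofReal_mul (by positivity), ← Real.exp_add]
    congr 2
    ring
  obtain ⟨C, hC⟩ := herg.ae_eq_const_of_ae_eq_comp₀ (hmeas.mul he).nullMeasurable hinv
  have hinvh : ∫⁻ x, (h x)⁻¹ = C⁻¹ * ∫⁻ x, e x := by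
    rw [← lintegral_const_mul _ he]
    refine lintegral_congr_ae ?_
    filter_upwards [hC] with x hx
    rw [← show h x * e x = C from hx, ENNReal.mul_inv (Or.inr (hetop x)) (Or.inr (he0 x)),
      mul_assoc, ENNReal.inv_mul_cancel (he0 x) (hetop x), mul_one]
  rw [hinvh, show ∫⁻ x, e x = ⊤ from hv.lintegral_exp_tsum_eq_top (neg_pos.2 hβ)] at hc1
  -- The total mass is c·C⁻¹·∞, hence 0 or ∞ and never 1; `C = ⊤` is the first case.
  rcases eq_or_ne C⁻¹ 0 with h0 | h0
  · simp [h0] at hc1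
  · simp [ENNReal.mul_top h0, ENNReal.mul_top hc0] at hc1

/-- The positivity set of the lower average is invariant, so by ergodicity it is null or conull, and
conull is excluded. -/
lemma measure_typeIIOneSet_eq_zero (hv : IsSpikeSequence a v) (hφ : ∀ x, φ x = x + a)
    (hd : DenseRange (· • a : ℤ → UnitAddCircle)) (ha : addOrderOf a = 0) (hβ : β < 0)
    (hm : IsConformal φ (coboundarySum a v) β m) (herg : PreErgodic φ m) :
    m (typeIIOneSet φ (coboundarySum a v) β) = 0 := by
  have := hm.isProbabilityMeasure
  set B := {x | 0 < lowerExpAverage φ (coboundarySum a v) β x} with hB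
  have hBm : MeasurableSet B := measurableSet_lt measurable_const
    (measurable_lowerExpAverage φ hv.continuous_coboundarySum β)
  have hBinv : φ ⁻¹' B = B := by
    ext x
    change 0 < lowerExpAverage φ _ β (φ x) ↔ 0 < lowerExpAverage φ _ β x
    rw [← lowerExpAverage_comp φ _ β x, ENNReal.mul_pos_iff]
    simp [Real.exp_pos]
  refine measure_mono_null (t := B) (by rw [typeIIOneSet_eq]; exact sdiff_subset) ?_
  refine (herg.prob_eq_zero_or_one hBm hBinv).resolve_right fun h1 => ?_
  exact hv.not_ae_lowerExpAverage_pos hφ hd ha hβ hm ((prob_compl_eq_zero_iff hBm).2 h1)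

end IsSpikeSequence

/-! ### The remaining types and the conclusion -/

/-- An ergodic measure without type `I` and type `II₁` part is of type `II_∞` or of type `III`. -/
lemma isTypeIIInfty_or_isTypeIII {X : Type*} [TopologicalSpace X] [MeasurableSpace X]
    {φ : X ≃ₜ X} {F : X → ℝ} {β : ℝ} {m : Measure X} [IsProbabilityMeasure m]
    (herg : PreErgodic φ m) (hI : m (typeISet φ F β) = 0) (hII : m (typeIIOneSet φ F β) = 0) :
    IsTypeIIInfty φ F β m ∨ IsTypeIII φ F β m := by
  by_cases h : ∃ A : Set X, MeasurableSet A ∧ φ ⁻¹' A = A ∧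
      (∃ u : X → ℝ, Measurable u ∧ ∀ x ∈ A, β * F x = u (φ x) - u x) ∧ m A ≠ 0
  · obtain ⟨A, hA, hAinv, hu, hmA⟩ := h
    have hAc : m Aᶜ = 0 :=
      (prob_compl_eq_zero_iff hA).2 ((herg.prob_eq_zero_or_one hA hAinv).resolve_left hmA)
    -- A solution on a set of positive measure lives on a conull set by ergodicity, so its null
    -- complement serves as the type III part.
    refine Or.inl ⟨Aᶜ, ⟨hA.compl, by rw [preimage_compl, hAinv], by rwa [compl_compl],
      fun B hB _ _ _ _ _ => measure_mono_null hB hAc⟩, ?_⟩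
    have h0 : m (typeISet φ F β ∪ typeIIOneSet φ F β ∪ Aᶜ) = 0 :=
      measure_union_null (measure_union_null hI hII) hAc
    rw [compl_eq_univ_sdiff, measure_sdiff_null h0, measure_univ]
  · push Not at h
    refine Or.inr ⟨univ, ⟨MeasurableSet.univ, preimage_univ, ⟨0, measurable_zero, by simp⟩,
      fun A _ hA hAinv u hu hAu => h A hA hAinv ⟨u, hu, hAu⟩⟩, measure_univ⟩

end CrossedFlow

theorem proposition7p3 (α : ℝ) (hα : Irrational α)
    (φ : UnitAddCircle ≃ₜ UnitAddCircle) (hφ : ∀ x, φ x = x + (α : UnitAddCircle)) :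
    ∃ F : UnitAddCircle → ℝ, Continuous F ∧
      (∀ β : ℝ, ∃ m : Measure UnitAddCircle, CrossedFlow.IsConformal φ F β m) ∧
      (∀ β : ℝ, 0 ≤ β → ∃! m : Measure UnitAddCircle,
        CrossedFlow.IsConformal φ F β m ∧ PreErgodic φ m ∧ CrossedFlow.IsTypeIIOne φ F β m) ∧
      (∀ β : ℝ, β < 0 → ∀ m : Measure UnitAddCircle,
        CrossedFlow.IsConformal φ F β m → PreErgodic φ m →
          CrossedFlow.IsTypeIIInfty φ F β m ∨ CrossedFlow.IsTypeIII φ F β m) := by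
  obtain ⟨v, hv⟩ := CrossedFlow.exists_isSpikeSequence (α : UnitAddCircle)
  have hd : DenseRange (· • (α : UnitAddCircle) : ℤ → UnitAddCircle) :=
    AddCircle.denseRange_zsmul_coe_iff.2 (by simpa using hα)
  have ha : addOrderOf (α : UnitAddCircle) = 0 := AddCircle.denseRange_zsmul_iff.1 hd
  refine ⟨CrossedFlow.coboundarySum α v, hv.continuous_coboundarySum,
    fun β => hv.exists_isConformal hφ β,
    fun β hβ => hv.existsUnique_isTypeIIOne hφ hd ha hβ, fun β hβ m hm herg => ?_⟩
  have := hm.isProbabilityMeasure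
  exact CrossedFlow.isTypeIIInfty_or_isTypeIII herg
    (by rw [hv.typeISet_eq_empty hφ ha, measure_empty])
    (hv.measure_typeIIOneSet_eq_zero hφ hd ha hβ hm herg)
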